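/- Let $A$ and $B$ be finite-dimensional quantum systems with fixed bases, $\mathcal H_A=\mathbb C^{d_A}$, $\mathcal H_B=\mathbb C^{d_B}$, and let $\Phi_1\neq\Phi_2:\mathcal L(\mathcal H_A)\to\mathcal L(\mathcal H_B)$ be two distinct quantum channels (completely positive trace-preserving maps), $\Delta=\Phi_1-\Phi_2$. Write $\|X\|_1=\operatorname{Tr}\sqrt{X^\dagger X}$ and $|X|=\sqrt{X^\dagger X}$, and let $J(\Delta)=\sum_{i,j}\Delta(|i\rangle\langle j|)\otimes|i\rangle\langle j|\in\mathcal L(\mathcal H_B\otimes\mathcal H_A)$ be the Choi operator, $\|\Delta\|_{ME}=\|J(\Delta)/d_A\|_1$, and $\|\Delta\|_\diamond=\max_\rho\|(\Delta\otimes I_{A'})\rho\|_1$, where the maximum is over all states $\rho$ of $A$ together with an ancilla $A'$ of any finite dimension. For an input state $\rho$ on $A\otimes A'$, let $P(\rho)$ be the maximal probability, over two-outcome measurements on $B\otimes A'$, of guessing correctly which of $\Phi_1,\Phi_2$ (each realised with probability $1/2$) was applied to the $A$ part of $\rho$. The state $\rho$ is optimal if $P(\rho)\ge P(\rho')$ for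 all input states $\rho'$ with an arbitrary finite-dimensional ancilla. A state is separable if it is a finite convex combination of product states, and entangled otherwise. Suppose that $\Phi_1,\Phi_2$ form a Maximal Entanglement Worst Case pair, that is, $\|\Delta\|_\diamond=d_A\|\Delta\|_{ME}$. Then there is a unit vector $|\phi\rangle\in\mathcal H_A$ such that the M-operator satisfies $$\operatorname{Tr}_B|J(\Delta)|=\|J(\Delta)\|_1\,|\phi\rangle\langle\phi| ,$$ and, with $|\bar\phi\rangle$ denoting the entrywise complex conjugate of $|\phi\rangle$ in the basis used in the definition of $J$, the following hold for every finite-dimensional ancilla $A'$: 1. a state $\rho$ on $A\otimes A'$ is optimal if and only if $\rho=|\bar\phi\rangle\langle\bar\phi|\otimes\tau$ for some state $\tau$ on $A'$; 2. in particular, every optimal input state is separable; 3. every entangled input state $\rho$ on $A\otimes A'$ is strictly worse: $P(\rho)<P(\rho')$ for every optimal input state $\rho'$ (with any finite-dimensional ancilla). -/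

import Mathlib

open scoped Kronecker MatrixOrder ComplexOrder

noncomputable section

namespace ChannelDiscrimination

section Channels

open scoped CStarAlgebra Matrix.Norms.L2Operator

/-- A quantum channel from `L(ℂ^A)` to `L(ℂ^B)`: a completely positive, trace preserving linear
map. Complete positivity is Mathlib's notion, for matrix algebras with the operator norm and the
positive-semidefinite (Loewner) order. -/
structure QuantumChannel (A B : Type*) [Fintype A] [DecidableEq A] [Fintype B]
    [DecidableEq B] where
  toLinearMap : Matrix A A ℂ →ₗ[ℂ] Matrix B B ℂ
  completelyPositive : ∃ Ψ : Matrix A A ℂ →CP Matrix B B ℂ, ∀ X, Ψ X = toLinearMap X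
  tracePreserving : ∀ X, (toLinearMap X).trace = X.trace

end Channels

/-- Density operators: positive semidefinite with trace one. -/
def IsDensity {n : Type*} [Fintype n] (ρ : Matrix n n ℂ) : Prop :=
  ρ.PosSemidef ∧ ρ.trace = 1

/-- The operator `|φ⟩⟨φ|`. -/
def ketbra {n : Type*} (φ : n → ℂ) : Matrix n n ℂ :=
  Matrix.vecMulVec φ (star φ)

/-- `φ` is a unit vector, so that `|φ⟩⟨φ|` is a pure state. -/
def IsUnitVector {n : Type*} [Fintype n] (φ : n → ℂ) : Prop :=
  ∑ i, ‖φ i‖ ^ 2 = 1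

/-- The trace norm `‖X‖₁ = Tr √(X† X)`. -/
def traceNorm {n : Type*} [Fintype n] [DecidableEq n] (X : Matrix n n ℂ) : ℝ :=
  (CFC.abs X).trace.re

/-- The map `S ⊗ id` on `L(ℂ^A ⊗ ℂ^A')`: `S` is applied to each `A`-block of the operator. -/
def applyLeft {A B : Type*} (S : Matrix A A ℂ →ₗ[ℂ] Matrix B B ℂ) {A' : Type*}
    (ρ : Matrix (A × A') (A × A') ℂ) : Matrix (B × A') (B × A') ℂ :=
  Matrix.of fun x y => S (Matrix.of fun i j => ρ (i, x.2) (j, y.2)) x.1 y.1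

/-- The Choi operator `J(S) = ∑ᵢⱼ S(|i⟩⟨j|) ⊗ |i⟩⟨j|`. -/
def choi {A B : Type*} [Fintype A] [DecidableEq A] (S : Matrix A A ℂ →ₗ[ℂ] Matrix B B ℂ) :
    Matrix (B × A) (B × A) ℂ :=
  ∑ i, ∑ j, S (Matrix.single i j 1) ⊗ₖ Matrix.single i j (1 : ℂ)

/-- The partial trace over the first tensor factor. -/
def partialTraceLeft {A B : Type*} [Fintype B] (X : Matrix (B × A) (B × A) ℂ) : Matrix A A ℂ :=
  Matrix.of fun i j => ∑ b, X (b, i) (b, j)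

section Norms

variable {A B : Type*} [Fintype A] [DecidableEq A] [Fintype B] [DecidableEq B]

/-- The M-operator `Tr_B |J(S)|`. -/
def mOperator (S : Matrix A A ℂ →ₗ[ℂ] Matrix B B ℂ) : Matrix A A ℂ :=
  partialTraceLeft (CFC.abs (choi S))

/-- The maximal entanglement norm `‖J(S) / d_A‖₁`. -/
def meNorm (S : Matrix A A ℂ →ₗ[ℂ] Matrix B B ℂ) : ℝ :=
  traceNorm ((Fintype.card A : ℂ)⁻¹ • choi S)

/-- The diamond norm: the supremum of `‖(S ⊗ id) ρ‖₁` over all states `ρ` of the input system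
together with an ancilla of arbitrary finite dimension. -/
def diamondNorm (S : Matrix A A ℂ →ₗ[ℂ] Matrix B B ℂ) : ℝ :=
  sSup {x : ℝ | ∃ (n : ℕ) (ρ : Matrix (A × Fin n) (A × Fin n) ℂ),
    IsDensity ρ ∧ x = traceNorm (applyLeft S ρ)}

/-- The difference map `Δ = Φ₁ - Φ₂`. -/
def differenceMap (Φ₁ Φ₂ : QuantumChannel A B) : Matrix A A ℂ →ₗ[ℂ] Matrix B B ℂ :=
  Φ₁.toLinearMap - Φ₂.toLinearMap

/-- Maximal Entanglement Worst Case pairs: `‖Δ‖_⋄ = d_A ‖Δ‖_ME`. -/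
def IsMEWC (Φ₁ Φ₂ : QuantumChannel A B) : Prop :=
  diamondNorm (differenceMap Φ₁ Φ₂) = (Fintype.card A : ℝ) * meNorm (differenceMap Φ₁ Φ₂)

/-- The largest probability of guessing correctly which of the two channels (each realised with
probability `1/2`) acted on the input state `ρ`, over all two-outcome measurements
`{E₁, E₂}` of the output together with the ancilla. -/
def successProb {A' : Type*} [Fintype A'] [DecidableEq A'] (Φ₁ Φ₂ : QuantumChannel A B)
    (ρ : Matrix (A × A') (A × A') ℂ) : ℝ :=
  sSup {p : ℝ | ∃ E₁ E₂ : Matrix (B × A') (B × A') ℂ,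
    E₁.PosSemidef ∧ E₂.PosSemidef ∧ E₁ + E₂ = 1 ∧
    p = 1 / 2 * (E₁ * applyLeft Φ₁.toLinearMap ρ).trace.re
      + 1 / 2 * (E₂ * applyLeft Φ₂.toLinearMap ρ).trace.re}

/-- An input state is optimal for discriminating `Φ₁` and `Φ₂` if no input state, with an ancilla
of any finite dimension, has a larger success probability. -/
def IsOptimalInput {A' : Type*} [Fintype A'] [DecidableEq A'] (Φ₁ Φ₂ : QuantumChannel A B)
    (ρ : Matrix (A × A') (A × A') ℂ) : Prop :=
  IsDensity ρ ∧ ∀ (n : ℕ) (ρ' : Matrix (A × Fin n) (A × Fin n) ℂ), IsDensity ρ' →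
    successProb Φ₁ Φ₂ ρ' ≤ successProb Φ₁ Φ₂ ρ

end Norms

/-- Separable states: convex combinations of product states. -/
def IsSeparableState {A A' : Type*} [Fintype A] [Fintype A'] (ρ : Matrix (A × A') (A × A') ℂ) : Prop :=
  ∃ (k : ℕ) (p : Fin k → ℝ) (α : Fin k → Matrix A A ℂ) (β : Fin k → Matrix A' A' ℂ),
    (∀ i, 0 ≤ p i) ∧ ∑ i, p i = 1 ∧ (∀ i, IsDensity (α i)) ∧ (∀ i, IsDensity (β i)) ∧
    ρ = ∑ i, (p i : ℂ) • (α i ⊗ₖ β i)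

/-- Entangled states: states that are not separable. -/
def IsEntangledState {A A' : Type*} [Fintype A] [Fintype A'] (ρ : Matrix (A × A') (A × A') ℂ) : Prop :=
  IsDensity ρ ∧ ¬ IsSeparableState ρ

end ChannelDiscrimination

end

open ChannelDiscrimination

/-!
Write `J` for the Choi operator of `Δ = Φ₁ - Φ₂`, `M = Tr_B |J|` for the M-operator and `ρ_A` for
the marginal of an input `ρ` on the system. The success probability is `1/2 + ‖(Δ ⊗ id) ρ‖₁ / 4`
(`successProb_eq`), so everything is about the output trace norm.

Complete positivity enters only through the Hermiticity of `J`. Splitting `J = J⁺ - J⁻` and using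
that a positive Choi operator maps positive inputs to positive outputs gives
`‖(Δ ⊗ id) ρ‖₁ ≤ Tr (M ρ_Aᵀ)` (`traceNorm_applyLeft_le`). Hence the diamond norm is at most the
largest eigenvalue of `M`, which is at most `Tr M = ‖J‖₁ = d_A ‖Δ‖_ME`. For a Maximal Entanglement
Worst Case pair both inequalities are equalities, so the positive operator `M` has a single nonzero
eigenvalue: `M = ‖J‖₁ |φ⟩⟨φ|` (`IsMEWC.exists_mOperator_eq`).

Since the marginal of `|J|` is carried by `φ`, so is `J` itself, that is
`J = Δ(|φ̄⟩⟨φ̄|) ⊗ |φ⟩⟨φ|` (`choi_eq_of_mOperator_eq`). Therefore every input `|φ̄⟩⟨φ̄| ⊗ τ` produces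
the output trace norm `‖J‖₁` (`successProb_ketbra_kronecker`). Conversely the bound above reads
`‖(Δ ⊗ id) ρ‖₁ ≤ ‖J‖₁ ⟨φ̄|ρ_A|φ̄⟩`; as `J ≠ 0`, an input reaching the value `‖J‖₁` has the pure
marginal `ρ_A = |φ̄⟩⟨φ̄|` and must be a product
(`eq_ketbra_kronecker_of_le_successProb`). Product states are separable, so entangled inputs are
strictly worse.
-/

namespace ChannelDiscrimination

open Matrix

/-! ### Positive operators and the trace norm -/

section TraceNorm

variable {n m : Type*} [Fintype n] [DecidableEq n] [Fintype m] [DecidableEq m]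

lemma trace_mul_nonneg_of_posSemidef {P Q : Matrix n n ℂ} (hP : P.PosSemidef)
    (hQ : Q.PosSemidef) : 0 ≤ (P * Q).trace := by
  obtain ⟨C, rfl⟩ := CStarAlgebra.nonneg_iff_eq_star_mul_self.mp hP.nonneg
  rw [Matrix.mul_assoc, Matrix.trace_mul_comm]
  exact (hQ.mul_mul_conjTranspose_same C).trace_nonneg

/-- A positive operator with zero expectation in an orthogonal projection annihilates the
range of the projection. -/
lemma mul_eq_zero_of_trace_mul_eq_zero {P Q : Matrix n n ℂ} (hP : P.PosSemidef)
    (hQ : Q.IsHermitian) (hQQ : Q * Q = Q) (h : (P * Q).trace = 0) : P * Q = 0 := by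
  obtain ⟨C, rfl⟩ := CStarAlgebra.nonneg_iff_eq_star_mul_self.mp hP.nonneg
  have h0 : C * Q = 0 := by
    rw [← Matrix.trace_conjTranspose_mul_self_eq_zero_iff, Matrix.conjTranspose_mul, hQ.eq,
      Matrix.mul_assoc, Matrix.trace_mul_comm, ← h, Matrix.mul_assoc, Matrix.mul_assoc, hQQ,
      ← Matrix.mul_assoc]
    rfl
  rw [Matrix.mul_assoc, h0, Matrix.mul_zero]

lemma abs_eq_of_mul_self_eq {X P : Matrix n n ℂ} (hP : P.PosSemidef) (h : P * P = Xᴴ * X) :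
    CFC.abs X = P :=
  CFC.sqrt_unique h hP.nonneg

lemma abs_posSemidef (X : Matrix n n ℂ) : (CFC.abs X).PosSemidef :=
  nonneg_iff_posSemidef.mp (CFC.abs_nonneg X)

lemma traceNorm_nonneg (X : Matrix n n ℂ) : 0 ≤ traceNorm X :=
  (Complex.le_def.mp (abs_posSemidef X).trace_nonneg).1

lemma ofReal_traceNorm (X : Matrix n n ℂ) : (traceNorm X : ℂ) = (CFC.abs X).trace := by
  have h := Complex.le_def.mp (abs_posSemidef X).trace_nonneg
  exact Complex.ext rfl h.2

lemma traceNorm_eq_zero_iff {X : Matrix n n ℂ} : traceNorm X = 0 ↔ X = 0 := by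
  constructor
  · intro h
    have h0 : CFC.abs X = 0 := by
      rw [← (abs_posSemidef X).trace_eq_zero_iff, ← ofReal_traceNorm, h, Complex.ofReal_zero]
    have := CFC.abs_mul_abs X
    rw [h0, Matrix.mul_zero] at this
    exact Matrix.conjTranspose_mul_self_eq_zero.mp this.symm
  · rintro rfl
    simp [traceNorm]

lemma traceNorm_smul (c : ℂ) (X : Matrix n n ℂ) : traceNorm (c • X) = ‖c‖ * traceNorm X := by
  simp [traceNorm, CFC.abs_smul]

lemma abs_kronecker_of_posSemidef (X : Matrix n n ℂ) {τ : Matrix m m ℂ} (hτ : τ.PosSemidef) :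
    CFC.abs (X ⊗ₖ τ) = CFC.abs X ⊗ₖ τ := by
  refine abs_eq_of_mul_self_eq ((abs_posSemidef X).kronecker hτ) ?_
  rw [← Matrix.mul_kronecker_mul, Matrix.conjTranspose_kronecker, ← Matrix.mul_kronecker_mul,
    CFC.abs_mul_abs, hτ.1.eq, Matrix.star_eq_conjTranspose]

lemma traceNorm_kronecker_density (X : Matrix n n ℂ) {τ : Matrix m m ℂ} (hτ : IsDensity τ) :
    traceNorm (X ⊗ₖ τ) = traceNorm X := by
  simp [traceNorm, abs_kronecker_of_posSemidef X hτ.1, Matrix.trace_kronecker, hτ.2]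

/-- The spectral projection of a Hermitian matrix on `[0, ∞)` is an effect that cuts out its
positive part; indicator functions are continuous on the finite spectrum. -/
lemma exists_effect_mul_eq_posPart {X : Matrix n n ℂ} (hX : X.IsHermitian) :
    ∃ E : Matrix n n ℂ, E.PosSemidef ∧ (1 - E).PosSemidef ∧ E * X = X⁺ := by
  have hX' : IsSelfAdjoint X := hX
  have hfin : (spectrum ℝ X).Finite := Matrix.finite_real_spectrum
  have hc : ∀ f : ℝ → ℝ, ContinuousOn f (spectrum ℝ X) := fun f => hfin.continuousOn f
  refine ⟨cfc (fun x : ℝ => if 0 ≤ x then 1 else 0) X, ?_, ?_, ?_⟩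
  · refine nonneg_iff_posSemidef.mp (cfc_nonneg fun x _ => ?_)
    split_ifs <;> norm_num
  · refine nonneg_iff_posSemidef.mp (sub_nonneg.mpr (cfc_le_one _ _ fun x _ => ?_))
    split_ifs <;> norm_num
  · rw [CFC.posPart_def, cfcₙ_eq_cfc]
    nth_rewrite 2 [← cfc_id ℝ X]
    rw [← cfc_mul _ _ X (hc _) (hc _)]
    refine cfc_congr fun x _ => ?_
    by_cases h : 0 ≤ x
    · simp [h]
    · simp [h, (not_le.mp h).le]

/-- Among all decompositions `X = P - N` into positive operators, the spectral one has the smallest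
trace of `P`. -/
lemma trace_posPart_re_le {X P N : Matrix n n ℂ} (hX : X.IsHermitian) (hP : P.PosSemidef)
    (hN : N.PosSemidef) (h : X = P - N) : (X⁺).trace.re ≤ P.trace.re := by
  obtain ⟨E, hE, hE', hEX⟩ := exists_effect_mul_eq_posPart hX
  have h1 := (Complex.le_def.mp (trace_mul_nonneg_of_posSemidef hE hN)).1
  have h2 := (Complex.le_def.mp (trace_mul_nonneg_of_posSemidef hE' hP)).1
  rw [← hEX, h, Matrix.mul_sub, Matrix.trace_sub]
  rw [Matrix.sub_mul, Matrix.one_mul, Matrix.trace_sub] at h2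
  simp only [Complex.sub_re, Complex.zero_re] at *
  linarith

lemma traceNorm_eq_trace_posPart_add_trace_negPart {X : Matrix n n ℂ} (hX : X.IsHermitian) :
    traceNorm X = (X⁺).trace.re + (X⁻).trace.re := by
  have hX' : IsSelfAdjoint X := hX
  rw [traceNorm, ← CFC.posPart_add_negPart X, Matrix.trace_add, Complex.add_re]

lemma traceNorm_sub_le {P N : Matrix n n ℂ} (hP : P.PosSemidef) (hN : N.PosSemidef) :
    traceNorm (P - N) ≤ P.trace.re + N.trace.re := by
  have hX : (P - N).IsHermitian := hP.1.sub hN.1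
  have h := trace_posPart_re_le hX hP hN rfl
  have h' := trace_posPart_re_le (X := -(P - N)) hX.neg hN hP (by abel)
  rw [CFC.posPart_neg] at h'
  rw [traceNorm_eq_trace_posPart_add_trace_negPart hX]
  linarith

lemma two_mul_trace_posPart {X : Matrix n n ℂ} (hX : X.IsHermitian) (h0 : X.trace = 0) :
    2 * (X⁺).trace.re = traceNorm X := by
  have hX' : IsSelfAdjoint X := hX
  have h : (X⁺ - X⁻).trace.re = 0 := by rw [CFC.posPart_sub_negPart X, h0, Complex.zero_re]
  rw [Matrix.trace_sub, Complex.sub_re] at h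
  rw [traceNorm_eq_trace_posPart_add_trace_negPart hX]
  linarith

end TraceNorm

/-! ### Pure states -/

lemma ketbra_apply {n : Type*} (φ : n → ℂ) (i j : n) : ketbra φ i j = φ i * star (φ j) := rfl

lemma transpose_ketbra {n : Type*} (φ : n → ℂ) : (ketbra φ)ᵀ = ketbra (star φ) := by
  ext i j
  simp [ketbra_apply, mul_comm]

section PureStates

variable {n : Type*} [Fintype n]

lemma posSemidef_ketbra (φ : n → ℂ) : (ketbra φ).PosSemidef :=
  Matrix.posSemidef_vecMulVec_self_star φ

lemma isUnitVector_star {φ : n → ℂ} (hφ : IsUnitVector φ) : IsUnitVector (star φ) := by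
  simpa [IsUnitVector] using hφ

lemma IsUnitVector.dotProduct_star_self {φ : n → ℂ} (hφ : IsUnitVector φ) : φ ⬝ᵥ star φ = 1 := by
  have : φ ⬝ᵥ star φ = ((∑ i, ‖φ i‖ ^ 2 : ℝ) : ℂ) := by
    simp [dotProduct, Complex.mul_conj, Complex.normSq_eq_norm_sq]
  rw [this, hφ, Complex.ofReal_one]

lemma IsUnitVector.isDensity_ketbra {φ : n → ℂ} (hφ : IsUnitVector φ) : IsDensity (ketbra φ) :=
  ⟨posSemidef_ketbra φ, by rw [ketbra, Matrix.trace_vecMulVec, hφ.dotProduct_star_self]⟩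

lemma IsUnitVector.ketbra_mul_self {φ : n → ℂ} (hφ : IsUnitVector φ) :
    ketbra φ * ketbra φ = ketbra φ := by
  rw [ketbra, Matrix.vecMulVec_mul_vecMulVec, dotProduct_comm, hφ.dotProduct_star_self, one_smul]

variable [DecidableEq n]

lemma isHermitian_one_sub_ketbra (φ : n → ℂ) : (1 - ketbra φ).IsHermitian :=
  Matrix.isHermitian_one.sub (posSemidef_ketbra φ).1

lemma IsUnitVector.one_sub_ketbra_mul_self {φ : n → ℂ} (hφ : IsUnitVector φ) :
    (1 - ketbra φ) * (1 - ketbra φ) = 1 - ketbra φ := by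
  simp [Matrix.mul_sub, Matrix.sub_mul, hφ.ketbra_mul_self]

lemma isUnitVector_single (k : n) : IsUnitVector (Pi.single k (1 : ℂ)) := by
  rw [IsUnitVector, Finset.sum_eq_single k] <;> simp +contextual

/-- A positive semidefinite operator whose trace does not exceed the largest expectation value
over states has rank at most one: the eigenvalues other than the largest one must vanish. -/
lemma exists_eq_trace_smul_ketbra [Nonempty n] {M : Matrix n n ℂ} (hM : M.PosSemidef)
    (h : ∀ l : ℝ, (∀ σ : Matrix n n ℂ, IsDensity σ → (M * σ).trace.re ≤ l) → M.trace.re ≤ l) :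
    ∃ φ : n → ℂ, IsUnitVector φ ∧ M = M.trace • ketbra φ := by
  set ev := hM.1.eigenvalues with hev
  obtain ⟨k, hk⟩ := Finite.exists_max ev
  have hnn : ∀ i, 0 ≤ ev i := hM.eigenvalues_nonneg
  set U : Matrix n n ℂ := (hM.1.eigenvectorUnitary : Matrix n n ℂ) with hU
  have hUU : U * Uᴴ = 1 := (Matrix.mem_unitaryGroup_iff).mp hM.1.eigenvectorUnitary.2
  have hUU' : Uᴴ * U = 1 := (Matrix.mem_unitaryGroup_iff').mp hM.1.eigenvectorUnitary.2
  have hspec : M = U * diagonal (fun i => (ev i : ℂ)) * Uᴴ := by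
    have := hM.1.spectral_theorem
    rw [Unitary.conjStarAlgAut_apply] at this
    exact this
  have htr : M.trace.re = ∑ i, ev i := by
    rw [hM.1.trace_eq_sum_eigenvalues]; simp [hev]
  -- `M ≤ λ_max`, so the expectation values of `M` are bounded by its largest eigenvalue
  have hle : ∑ i, ev i ≤ ev k := by
    rw [← htr]
    refine h _ fun σ hσ => ?_
    have h1 : ((ev k : ℂ) • (1 : Matrix n n ℂ) - M).PosSemidef := by
      have : (ev k : ℂ) • (1 : Matrix n n ℂ) - M
          = U * diagonal (fun i => ((ev k - ev i : ℝ) : ℂ)) * Uᴴ := by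
        have hd : diagonal (fun i => ((ev k - ev i : ℝ) : ℂ))
            = (ev k : ℂ) • (1 : Matrix n n ℂ) - diagonal (fun i => (ev i : ℂ)) := by
          ext i j; by_cases hij : i = j <;> simp [hij]
        rw [hd, Matrix.mul_sub, Matrix.sub_mul, ← hspec]
        simp [hUU]
      rw [this]
      refine Matrix.PosSemidef.mul_mul_conjTranspose_same (Matrix.PosSemidef.diagonal ?_) U
      intro i
      exact Complex.zero_le_real.mpr (sub_nonneg.mpr (hk i))
    have h2 := (Complex.le_def.mp (trace_mul_nonneg_of_posSemidef h1 hσ.1)).1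
    rw [Matrix.sub_mul, Matrix.trace_sub, Matrix.smul_mul, Matrix.one_mul, Matrix.trace_smul,
      hσ.2] at h2
    simp at h2
    linarith
  -- the eigenvalues are nonnegative and their sum is at most one of them
  have hz : ∀ i, i ≠ k → ev i = 0 := by
    intro i hi
    have h1 : ev i + ev k ≤ ∑ i, ev i := by
      rw [← Finset.sum_pair hi]
      exact Finset.sum_le_sum_of_subset_of_nonneg (Finset.subset_univ _) fun j _ _ => hnn j
    linarith [hnn i]
  have hcol : ∑ i, U i k * star (U i k) = 1 := by
    have := congrFun (congrFun hUU' k) k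
    simpa [Matrix.mul_apply, mul_comm] using this
  have hM' : M = (ev k : ℂ) • ketbra (fun i => U i k) := by
    rw [hspec]
    ext i j
    rw [Matrix.mul_apply, Finset.sum_eq_single k]
    · simp [ketbra_apply]; ring
    · intro b _ hb
      simp [hz b hb]
    · simp
  have hunit : IsUnitVector (fun i => U i k) := by
    have : ((∑ i, ‖U i k‖ ^ 2 : ℝ) : ℂ) = 1 := by
      rw [← hcol]; simp [Complex.mul_conj, Complex.normSq_eq_norm_sq]
    exact_mod_cast this
  refine ⟨_, hunit, ?_⟩
  conv_rhs => rw [hM', Matrix.trace_smul, hunit.isDensity_ketbra.2]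
  simpa using hM'

end PureStates

/-! ### Partial traces and Choi operators -/

section PartialTrace

variable {A B C : Type*} [Fintype B]

lemma partialTraceLeft_posSemidef {X : Matrix (B × A) (B × A) ℂ} (hX : X.PosSemidef) :
    (partialTraceLeft X).PosSemidef := by
  have h : partialTraceLeft X
      = ∑ b, X.submatrix (fun i => (b, i)) (fun i => (b, i)) := by
    ext i j
    simp [partialTraceLeft, Matrix.sum_apply]
  rw [h]
  exact Matrix.posSemidef_sum _ fun b _ => hX.submatrix _

lemma trace_partialTraceLeft [Fintype A] (X : Matrix (B × A) (B × A) ℂ) :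
    (partialTraceLeft X).trace = X.trace := by
  simp only [Matrix.trace, Matrix.diag_apply, partialTraceLeft, Matrix.of_apply,
    Fintype.sum_prod_type]
  exact Finset.sum_comm

lemma trace_mul_one_kronecker [Fintype A] [DecidableEq B] (X : Matrix (B × A) (B × A) ℂ)
    (Q : Matrix A A ℂ) : (X * ((1 : Matrix B B ℂ) ⊗ₖ Q)).trace = (partialTraceLeft X * Q).trace := by
  have h : ∀ b i, (X * ((1 : Matrix B B ℂ) ⊗ₖ Q)) (b, i) (b, i) = ∑ j, X (b, i) (b, j) * Q j i := by
    intro b i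
    simp [Matrix.mul_apply, Fintype.sum_prod_type_right, Matrix.one_apply]
  simp only [Matrix.trace, Matrix.diag_apply, Fintype.sum_prod_type_right, h]
  refine Finset.sum_congr rfl fun i _ => ?_
  simp only [Matrix.mul_apply, partialTraceLeft, Matrix.of_apply, Finset.sum_mul]
  exact Finset.sum_comm

/-- The marginal of a bipartite operator on the first tensor factor. -/
def partialTraceRight [Fintype C] (ρ : Matrix (A × C) (A × C) ℂ) : Matrix A A ℂ :=
  partialTraceLeft (ρ.submatrix Prod.swap Prod.swap)

end PartialTrace

/-- The operator `∑ᵢⱼ Tᵢⱼ ⊗ ρᵢⱼ` obtained from the blocks of `T` and `ρ` along the common factor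
`A`: the image of `ρ` under `S ⊗ id`, where `S` is the map with Choi operator `T`. -/
def choiAction {A B C : Type*} [Fintype A] (T : Matrix (B × A) (B × A) ℂ)
    (ρ : Matrix (A × C) (A × C) ℂ) : Matrix (B × C) (B × C) ℂ :=
  Matrix.of fun x y => ∑ i, ∑ j, T (x.1, i) (y.1, j) * ρ (i, x.2) (j, y.2)

section Choi

variable {A B C : Type*} [Fintype A]

lemma choiAction_sub (T S : Matrix (B × A) (B × A) ℂ) (ρ : Matrix (A × C) (A × C) ℂ) :
    choiAction (T - S) ρ = choiAction T ρ - choiAction S ρ := by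
  ext x y
  simp [choiAction, sub_mul, Finset.sum_sub_distrib]

lemma choiAction_add (T S : Matrix (B × A) (B × A) ℂ) (ρ : Matrix (A × C) (A × C) ℂ) :
    choiAction (T + S) ρ = choiAction T ρ + choiAction S ρ := by
  ext x y
  simp [choiAction, add_mul, Finset.sum_add_distrib]

lemma choiAction_isHermitian {T : Matrix (B × A) (B × A) ℂ} {ρ : Matrix (A × C) (A × C) ℂ}
    (hT : T.IsHermitian) (hρ : ρ.IsHermitian) : (choiAction T ρ).IsHermitian := by
  ext x y
  simp only [choiAction, Matrix.conjTranspose_apply, Matrix.of_apply, star_sum, star_mul',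
    hT.apply, hρ.apply]
  exact Finset.sum_comm

/-- The easy half of Choi's theorem: a positive semidefinite Choi operator gives a completely
positive map. -/
lemma choiAction_posSemidef [Fintype B] [Fintype C] [DecidableEq A] [DecidableEq B] [DecidableEq C]
    {T : Matrix (B × A) (B × A) ℂ} {ρ : Matrix (A × C) (A × C) ℂ}
    (hT : T.PosSemidef) (hρ : ρ.PosSemidef) :
    (choiAction T ρ).PosSemidef := by
  -- `choiAction T ρ` sums the rows and the columns of a principal submatrix of `T ⊗ ρ` over `A`
  set N : Matrix ((B × C) × A) ((B × C) × A) ℂ :=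
    (T ⊗ₖ ρ).submatrix (fun p => ((p.1.1, p.2), (p.2, p.1.2)))
      (fun p => ((p.1.1, p.2), (p.2, p.1.2))) with hN
  set V : Matrix (B × C) ((B × C) × A) ℂ := Matrix.of fun x p => if x = p.1 then 1 else 0 with hV
  have h : choiAction T ρ = V * N * Vᴴ := by
    ext x y
    simp only [hV, Matrix.mul_apply, Matrix.of_apply, Matrix.conjTranspose_apply,
      Fintype.sum_prod_type_right (α₁ := B × C), ite_mul, one_mul, zero_mul, Finset.sum_ite_eq,
      Finset.mem_univ, if_true, RCLike.star_def, apply_ite (starRingEnd ℂ), map_one, map_zero,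
      mul_ite, mul_one, mul_zero]
    exact Finset.sum_comm
  rw [h]
  exact ((hT.kronecker hρ).submatrix _).mul_mul_conjTranspose_same V

lemma trace_choiAction [Fintype B] [Fintype C] (T : Matrix (B × A) (B × A) ℂ)
    (ρ : Matrix (A × C) (A × C) ℂ) :
    (choiAction T ρ).trace = (partialTraceLeft T * (partialTraceRight ρ)ᵀ).trace := by
  simp only [Matrix.trace, Matrix.diag_apply, Matrix.mul_apply, Fintype.sum_prod_type,
    partialTraceLeft, partialTraceRight, choiAction, Matrix.of_apply, Matrix.transpose_apply,
    Matrix.submatrix_apply, Prod.swap, Finset.sum_mul_sum]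
  simp only [← Fintype.sum_prod_type']
  exact Fintype.sum_equiv (Equiv.prodAssoc _ _ _ |>.symm.trans (Equiv.prodComm _ _) |>.trans
    (Equiv.prodAssoc _ _ _)) _ _ fun _ => rfl

lemma trace_applyLeft [Fintype B] [Fintype C] {S : Matrix A A ℂ →ₗ[ℂ] Matrix B B ℂ}
    (hS : ∀ X, (S X).trace = X.trace) (ρ : Matrix (A × C) (A × C) ℂ) :
    (applyLeft S ρ).trace = ρ.trace := by
  simp only [Matrix.trace, Matrix.diag_apply, Fintype.sum_prod_type_right, applyLeft,
    Matrix.of_apply]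
  refine Finset.sum_congr rfl fun a _ => ?_
  simpa [Matrix.trace] using hS (Matrix.of fun i j => ρ (i, a) (j, a))

variable [DecidableEq A]

lemma choi_apply (S : Matrix A A ℂ →ₗ[ℂ] Matrix B B ℂ) (x y : B × A) :
    choi S x y = S (Matrix.single x.2 y.2 1) x.1 y.1 := by
  simp only [choi, Matrix.sum_apply, Matrix.kroneckerMap_apply, Matrix.single_apply, mul_ite,
    mul_one, mul_zero]
  rw [Finset.sum_eq_single x.2, Finset.sum_eq_single y.2] <;> simp +contextual

lemma linearMap_apply_eq_sum (S : Matrix A A ℂ →ₗ[ℂ] Matrix B B ℂ) (X : Matrix A A ℂ) (b b' : B) :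
    S X b b' = ∑ i, ∑ j, choi S (b, i) (b', j) * X i j := by
  conv_lhs => rw [Matrix.matrix_eq_sum_single X]
  have h : ∀ i j, Matrix.single i j (X i j) = X i j • Matrix.single i j (1 : ℂ) := by
    intro i j; simp
  simp_rw [h, map_sum, map_smul, Matrix.sum_apply, Matrix.smul_apply, choi_apply, smul_eq_mul,
    mul_comm]

lemma applyLeft_eq_choiAction (S : Matrix A A ℂ →ₗ[ℂ] Matrix B B ℂ) (ρ : Matrix (A × C) (A × C) ℂ) :
    applyLeft S ρ = choiAction (choi S) ρ := by
  ext x y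
  simp [applyLeft, choiAction, linearMap_apply_eq_sum]

lemma applyLeft_kronecker (S : Matrix A A ℂ →ₗ[ℂ] Matrix B B ℂ) (X : Matrix A A ℂ)
    (τ : Matrix C C ℂ) : applyLeft S (X ⊗ₖ τ) = S X ⊗ₖ τ := by
  ext x y
  simp [applyLeft_eq_choiAction, choiAction, linearMap_apply_eq_sum, Finset.sum_mul, mul_assoc]

lemma choi_eq_zero_iff {S : Matrix A A ℂ →ₗ[ℂ] Matrix B B ℂ} : choi S = 0 ↔ S = 0 := by
  constructor
  · intro h
    ext X b b'
    rw [linearMap_apply_eq_sum, h]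
    simp
  · rintro rfl
    ext x y
    simp [choi_apply]

end Choi

section Hermitian

open scoped CStarAlgebra Matrix.Norms.L2Operator

variable {A B : Type*} [Fintype A] [DecidableEq A] [Fintype B] [DecidableEq B]

/-- Positive maps between C⋆-algebras preserve the star operation. -/
lemma QuantumChannel.map_conjTranspose (Φ : QuantumChannel A B) (X : Matrix A A ℂ) :
    Φ.toLinearMap Xᴴ = (Φ.toLinearMap X)ᴴ := by
  obtain ⟨Ψ, hΨ⟩ := Φ.completelyPositive
  rw [← hΨ, ← hΨ]
  exact map_star Ψ X

end Hermitian

/-! ### Product states and marginals -/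

section States

variable {A B C : Type*} [Fintype A] [Fintype B] [Fintype C]

lemma IsDensity.transpose {σ : Matrix A A ℂ} (hσ : IsDensity σ) : IsDensity σᵀ :=
  ⟨hσ.1.transpose, by rw [Matrix.trace_transpose, hσ.2]⟩

lemma trace_submatrix_swap (ρ : Matrix (A × C) (A × C) ℂ) :
    (ρ.submatrix Prod.swap Prod.swap).trace = ρ.trace :=
  Fintype.sum_equiv (Equiv.prodComm C A) _ _ fun _ => rfl

lemma IsDensity.submatrix_swap {ρ : Matrix (A × C) (A × C) ℂ} (hρ : IsDensity ρ) :
    IsDensity (ρ.submatrix Prod.swap Prod.swap) :=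
  ⟨hρ.1.submatrix _, by rw [trace_submatrix_swap, hρ.2]⟩

lemma IsDensity.partialTraceRight {ρ : Matrix (A × C) (A × C) ℂ} (hρ : IsDensity ρ) :
    IsDensity (partialTraceRight ρ) :=
  ⟨partialTraceLeft_posSemidef hρ.submatrix_swap.1, by
    rw [ChannelDiscrimination.partialTraceRight, trace_partialTraceLeft, hρ.submatrix_swap.2]⟩

lemma IsDensity.kronecker [DecidableEq A] [DecidableEq C] {σ : Matrix A A ℂ} {τ : Matrix C C ℂ}
    (hσ : IsDensity σ) (hτ : IsDensity τ) : IsDensity (σ ⊗ₖ τ) :=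
  ⟨hσ.1.kronecker hτ.1, by rw [Matrix.trace_kronecker, hσ.2, hτ.2, one_mul]⟩

lemma isSeparableState_kronecker {σ : Matrix A A ℂ} {τ : Matrix C C ℂ} (hσ : IsDensity σ)
    (hτ : IsDensity τ) : IsSeparableState (σ ⊗ₖ τ) :=
  ⟨1, fun _ => 1, fun _ => σ, fun _ => τ, by simp, by simp, fun _ => hσ, fun _ => hτ, by simp⟩

variable [DecidableEq A] [DecidableEq B]

/-- If the marginal of a positive semidefinite `X` on the second factor has no weight outside
`φ`, then `X` has no weight outside `1 ⊗ |φ⟩⟨φ|`. -/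
lemma mul_one_kronecker_one_sub_ketbra {X : Matrix (B × A) (B × A) ℂ} (hX : X.PosSemidef)
    {φ : A → ℂ} (hφ : IsUnitVector φ)
    (h : (partialTraceLeft X * ketbra φ).trace = (partialTraceLeft X).trace) :
    X * ((1 : Matrix B B ℂ) ⊗ₖ (1 - ketbra φ)) = 0 := by
  refine mul_eq_zero_of_trace_mul_eq_zero hX ?_ ?_ ?_
  · rw [Matrix.IsHermitian, Matrix.conjTranspose_kronecker, Matrix.conjTranspose_one,
      (isHermitian_one_sub_ketbra φ).eq]
  · rw [← Matrix.mul_kronecker_mul, hφ.one_sub_ketbra_mul_self, Matrix.one_mul]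
  · rw [trace_mul_one_kronecker, Matrix.mul_sub, Matrix.trace_sub, h, Matrix.mul_one, sub_self]

/-- A Hermitian operator supported on `1 ⊗ |φ⟩⟨φ|` is a product; the first factor is obtained by
sandwiching with `φ`. -/
lemma eq_kronecker_ketbra_of_mul_eq_zero {X : Matrix (B × A) (B × A) ℂ} (hX : X.IsHermitian)
    {φ : A → ℂ} (h : X * ((1 : Matrix B B ℂ) ⊗ₖ (1 - ketbra φ)) = 0) :
    X = (Matrix.of fun b b' => ∑ i, ∑ j, X (b, i) (b', j) * (star (φ i) * φ j)) ⊗ₖ ketbra φ := by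
  have hk : (1 : Matrix B B ℂ) ⊗ₖ (1 - ketbra φ) = 1 - (1 : Matrix B B ℂ) ⊗ₖ ketbra φ := by
    rw [eq_sub_iff_add_eq, ← Matrix.kronecker_add, sub_add_cancel, Matrix.one_kronecker_one]
  rw [hk, Matrix.mul_sub, Matrix.mul_one, sub_eq_zero] at h
  have hr : ∀ x b j, X x (b, j) = ∑ k, X x (b, k) * ketbra φ k j := by
    intro x b j
    conv_lhs => rw [h]
    simp [Matrix.mul_apply, Fintype.sum_prod_type_right, Matrix.one_apply]
  have hl : ∀ b i y, X (b, i) y = ∑ k, ketbra φ i k * X (b, k) y := by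
    intro b i y
    rw [← hX.apply, hr, star_sum]
    refine Finset.sum_congr rfl fun k _ => ?_
    rw [star_mul', hX.apply, (posSemidef_ketbra φ).1.apply, mul_comm]
  ext ⟨b, i⟩ ⟨b', j⟩
  rw [hl]
  simp_rw [hr _ b' j]
  simp only [Matrix.kroneckerMap_apply, Matrix.of_apply, Finset.sum_mul, Finset.mul_sum,
    ketbra_apply]
  refine Finset.sum_congr rfl fun k _ => Finset.sum_congr rfl fun l _ => ?_
  ring

/-- A state whose first marginal is the pure state `φ` is a product state. -/
lemma IsDensity.eq_ketbra_kronecker [DecidableEq C] {ρ : Matrix (A × C) (A × C) ℂ}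
    (hρ : IsDensity ρ) {φ : A → ℂ} (hφ : IsUnitVector φ)
    (h : (ChannelDiscrimination.partialTraceRight ρ * ketbra φ).trace = 1) :
    ∃ τ : Matrix C C ℂ, IsDensity τ ∧ ρ = ketbra φ ⊗ₖ τ := by
  have hσ := hρ.submatrix_swap
  have h1 := eq_kronecker_ketbra_of_mul_eq_zero hσ.1.1
    (mul_one_kronecker_one_sub_ketbra hσ.1 hφ (h.trans hρ.partialTraceRight.2.symm))
  set τ : Matrix C C ℂ := Matrix.of fun b b' => ∑ i, ∑ j,
    ρ.submatrix Prod.swap Prod.swap (b, i) (b', j) * (star (φ i) * φ j) with hτ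
  have h2 : ρ = ketbra φ ⊗ₖ τ := by
    ext ⟨i, b⟩ ⟨j, b'⟩
    have := congrFun (congrFun h1 (b, i)) (b', j)
    rw [Matrix.kroneckerMap_apply, mul_comm]
    exact this
  refine ⟨τ, ⟨?_, ?_⟩, h2⟩
  · -- `τ` is the second marginal of `ρ`
    have h3 : τ = partialTraceLeft ρ := by
      ext b b'
      have hs : ∑ i, ketbra φ i i = 1 := hφ.isDensity_ketbra.2
      rw [h2]
      simp only [partialTraceLeft, Matrix.of_apply, Matrix.kroneckerMap_apply]
      rw [← Finset.sum_mul, hs, one_mul]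
    rw [h3]
    exact partialTraceLeft_posSemidef hρ.1
  · have := hρ.2
    rwa [h2, Matrix.trace_kronecker, hφ.isDensity_ketbra.2, one_mul] at this

end States

/-! ### Discrimination of two channels -/

section Discrimination

variable {A B C : Type*} [Fintype A] [DecidableEq A] [Fintype B] [DecidableEq B] [Fintype C]
  [DecidableEq C]

/-- `Δ` preserves Hermiticity, being a difference of positive maps. -/
lemma choi_differenceMap_isHermitian (Φ₁ Φ₂ : QuantumChannel A B) :
    (choi (differenceMap Φ₁ Φ₂)).IsHermitian := by
  ext x y
  have h : differenceMap Φ₁ Φ₂ (Matrix.single x.2 y.2 1)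
      = (differenceMap Φ₁ Φ₂ (Matrix.single y.2 x.2 1))ᴴ := by
    simp only [differenceMap, LinearMap.sub_apply, Matrix.conjTranspose_sub,
      ← QuantumChannel.map_conjTranspose]
    simp
  rw [Matrix.conjTranspose_apply, choi_apply, choi_apply, h, Matrix.conjTranspose_apply]

lemma applyLeft_differenceMap_isHermitian {E : Type*} (Φ₁ Φ₂ : QuantumChannel A B)
    {ρ : Matrix (A × E) (A × E) ℂ} (hρ : ρ.IsHermitian) :
    (applyLeft (differenceMap Φ₁ Φ₂) ρ).IsHermitian := by
  rw [applyLeft_eq_choiAction]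
  exact choiAction_isHermitian (choi_differenceMap_isHermitian Φ₁ Φ₂) hρ

/-- Helstrom's formula for the optimal success probability. -/
lemma successProb_eq (Φ₁ Φ₂ : QuantumChannel A B) {ρ : Matrix (A × C) (A × C) ℂ}
    (hρ : IsDensity ρ) :
    successProb Φ₁ Φ₂ ρ = 1 / 2 + 1 / 4 * traceNorm (applyLeft (differenceMap Φ₁ Φ₂) ρ) := by
  set X := applyLeft (differenceMap Φ₁ Φ₂) ρ with hX
  have hXH : X.IsHermitian := applyLeft_differenceMap_isHermitian Φ₁ Φ₂ hρ.1.1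
  have hsub : X = applyLeft Φ₁.toLinearMap ρ - applyLeft Φ₂.toLinearMap ρ := rfl
  have h1 := trace_applyLeft Φ₁.tracePreserving ρ
  have h2 := trace_applyLeft Φ₂.tracePreserving ρ
  rw [hρ.2] at h1 h2
  have hX0 : X.trace = 0 := by rw [hsub, Matrix.trace_sub, h1, h2, sub_self]
  have hval : ∀ E₁ E₂ : Matrix (B × C) (B × C) ℂ, E₁ + E₂ = 1 →
      1 / 2 * (E₁ * applyLeft Φ₁.toLinearMap ρ).trace.re
        + 1 / 2 * (E₂ * applyLeft Φ₂.toLinearMap ρ).trace.re = 1 / 2 + 1 / 2 * (E₁ * X).trace.re := by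
    intro E₁ E₂ h
    rw [eq_sub_of_add_eq' h, hsub, Matrix.mul_sub, Matrix.sub_mul, Matrix.one_mul,
      Matrix.trace_sub, Matrix.trace_sub, h2, Complex.sub_re, Complex.sub_re, Complex.one_re]
    ring
  have hmax : 1 / 2 + 1 / 4 * traceNorm X = 1 / 2 + 1 / 2 * (X⁺).trace.re := by
    rw [← two_mul_trace_posPart hXH hX0]; ring
  rw [hmax]
  refine IsGreatest.csSup_eq ⟨?_, ?_⟩
  · obtain ⟨E, hE, hE', hEX⟩ := exists_effect_mul_eq_posPart hXH
    exact ⟨E, 1 - E, hE, hE', by abel, by rw [hval _ _ (by abel), hEX]⟩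
  · rintro p ⟨E₁, E₂, hE₁, hE₂, hE, rfl⟩
    rw [hval _ _ hE]
    have hX' : IsSelfAdjoint X := hXH
    have hn := (Complex.le_def.mp (trace_mul_nonneg_of_posSemidef hE₁
      (nonneg_iff_posSemidef.mp (CFC.negPart_nonneg X)))).1
    have hp := (Complex.le_def.mp (trace_mul_nonneg_of_posSemidef hE₂
      (nonneg_iff_posSemidef.mp (CFC.posPart_nonneg X)))).1
    rw [eq_sub_of_add_eq' hE, Matrix.sub_mul, Matrix.one_mul, Matrix.trace_sub,
      Complex.sub_re] at hp
    have hd : (E₁ * X).trace.re = (E₁ * X⁺).trace.re - (E₁ * X⁻).trace.re := by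
      conv_lhs => rw [← CFC.posPart_sub_negPart X]
      rw [Matrix.mul_sub, Matrix.trace_sub, Complex.sub_re]
    simp only [Complex.zero_re] at hn hp
    linarith

/-- The trace norm of the output is controlled by the M-operator and the transposed marginal of
the input: split the Choi operator into its positive and negative parts. -/
lemma traceNorm_applyLeft_le (S : Matrix A A ℂ →ₗ[ℂ] Matrix B B ℂ) (hS : (choi S).IsHermitian)
    {ρ : Matrix (A × C) (A × C) ℂ} (hρ : ρ.PosSemidef) :
    traceNorm (applyLeft S ρ) ≤ (mOperator S * (partialTraceRight ρ)ᵀ).trace.re := by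
  have hS' : IsSelfAdjoint (choi S) := hS
  rw [mOperator, ← trace_choiAction, ← CFC.posPart_add_negPart (choi S), choiAction_add,
    Matrix.trace_add, Complex.add_re, applyLeft_eq_choiAction]
  conv_lhs => rw [← CFC.posPart_sub_negPart (choi S), choiAction_sub]
  exact traceNorm_sub_le
    (choiAction_posSemidef (nonneg_iff_posSemidef.mp (CFC.posPart_nonneg _)) hρ)
    (choiAction_posSemidef (nonneg_iff_posSemidef.mp (CFC.negPart_nonneg _)) hρ)

lemma trace_mOperator (S : Matrix A A ℂ →ₗ[ℂ] Matrix B B ℂ) :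
    (mOperator S).trace = (traceNorm (choi S) : ℂ) := by
  rw [mOperator, trace_partialTraceLeft, ofReal_traceNorm]

lemma card_mul_meNorm [Nonempty A] (S : Matrix A A ℂ →ₗ[ℂ] Matrix B B ℂ) :
    (Fintype.card A : ℝ) * meNorm S = traceNorm (choi S) := by
  rw [meNorm, traceNorm_smul]
  simp

/-- For a Maximal Entanglement Worst Case pair, the diamond norm, which is at most the largest
eigenvalue of the M-operator, equals its trace; hence the M-operator has rank one. -/
lemma IsMEWC.exists_mOperator_eq [Nonempty A] {Φ₁ Φ₂ : QuantumChannel A B} (h : IsMEWC Φ₁ Φ₂) :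
    ∃ φ : A → ℂ, IsUnitVector φ ∧ mOperator (differenceMap Φ₁ Φ₂)
        = (traceNorm (choi (differenceMap Φ₁ Φ₂)) : ℂ) • ketbra φ := by
  rw [← trace_mOperator]
  refine exists_eq_trace_smul_ketbra (partialTraceLeft_posSemidef (abs_posSemidef _)) ?_
  intro l hl
  rw [trace_mOperator, Complex.ofReal_re, ← card_mul_meNorm, ← h]
  obtain ⟨a⟩ := ‹Nonempty A›
  -- the supremum ranges over a nonempty set
  refine csSup_le ⟨_, 1, ketbra (Pi.single a 1) ⊗ₖ ketbra (Pi.single 0 1),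
    (isUnitVector_single a).isDensity_ketbra.kronecker (isUnitVector_single 0).isDensity_ketbra,
    rfl⟩ ?_
  rintro x ⟨n, ρ, hρ, rfl⟩
  exact (traceNorm_applyLeft_le _ (choi_differenceMap_isHermitian Φ₁ Φ₂) hρ.1).trans
    (hl _ hρ.partialTraceRight.transpose)

/-- If the M-operator has rank one, then the Choi operator is a product `S(|φ̄⟩⟨φ̄|) ⊗ |φ⟩⟨φ|`. -/
lemma choi_eq_of_mOperator_eq {S : Matrix A A ℂ →ₗ[ℂ] Matrix B B ℂ} (hS : (choi S).IsHermitian)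
    {φ : A → ℂ} (hφ : IsUnitVector φ)
    (hM : mOperator S = (traceNorm (choi S) : ℂ) • ketbra φ) :
    choi S = S (ketbra (star φ)) ⊗ₖ ketbra φ := by
  have h0 : CFC.abs (choi S) * ((1 : Matrix B B ℂ) ⊗ₖ (1 - ketbra φ)) = 0 := by
    refine mul_one_kronecker_one_sub_ketbra (abs_posSemidef _) hφ ?_
    change (mOperator S * ketbra φ).trace = (mOperator S).trace
    rw [hM, Matrix.smul_mul, hφ.ketbra_mul_self]
  -- the kernel of `|J|` is contained in the kernel of `J`
  have h1 : choi S * ((1 : Matrix B B ℂ) ⊗ₖ (1 - ketbra φ)) = 0 := by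
    rw [← Matrix.conjTranspose_mul_self_eq_zero, Matrix.conjTranspose_mul, Matrix.mul_assoc,
      ← Matrix.mul_assoc (choi S)ᴴ, ← Matrix.star_eq_conjTranspose (choi S), ← CFC.abs_mul_abs,
      Matrix.mul_assoc, h0, Matrix.mul_zero, Matrix.mul_zero]
  refine (eq_kronecker_ketbra_of_mul_eq_zero hS h1).trans ?_
  congr 1
  ext b b'
  simp [linearMap_apply_eq_sum, ketbra_apply]

variable {Φ₁ Φ₂ : QuantumChannel A B} {φ : A → ℂ}

/-- The optimal value `1/2 + ‖J‖₁/4` is attained by every product state `|φ̄⟩⟨φ̄| ⊗ τ`. -/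
lemma successProb_ketbra_kronecker (hφ : IsUnitVector φ)
    (hM : mOperator (differenceMap Φ₁ Φ₂)
        = (traceNorm (choi (differenceMap Φ₁ Φ₂)) : ℂ) • ketbra φ)
    {τ : Matrix C C ℂ} (hτ : IsDensity τ) :
    successProb Φ₁ Φ₂ (ketbra (star φ) ⊗ₖ τ)
      = 1 / 2 + 1 / 4 * traceNorm (choi (differenceMap Φ₁ Φ₂)) := by
  rw [successProb_eq Φ₁ Φ₂ ((isUnitVector_star hφ).isDensity_ketbra.kronecker hτ),
    applyLeft_kronecker, traceNorm_kronecker_density _ hτ,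
    choi_eq_of_mOperator_eq (choi_differenceMap_isHermitian Φ₁ Φ₂) hφ hM,
    traceNorm_kronecker_density _ hφ.isDensity_ketbra]

/-- The bound `‖(Δ ⊗ id) ρ‖₁ ≤ ‖J‖₁ ⟨φ̄|ρ_A|φ̄⟩`, in terms of success probabilities. -/
lemma successProb_le (hM : mOperator (differenceMap Φ₁ Φ₂)
        = (traceNorm (choi (differenceMap Φ₁ Φ₂)) : ℂ) • ketbra φ)
    {ρ : Matrix (A × C) (A × C) ℂ} (hρ : IsDensity ρ) :
    successProb Φ₁ Φ₂ ρ ≤ 1 / 2 + 1 / 4 * (traceNorm (choi (differenceMap Φ₁ Φ₂)) *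
      (partialTraceRight ρ * ketbra (star φ)).trace.re) := by
  have h := traceNorm_applyLeft_le _ (choi_differenceMap_isHermitian Φ₁ Φ₂) hρ.1
  rw [hM, Matrix.smul_mul, Matrix.trace_smul, smul_eq_mul, Complex.re_ofReal_mul,
    ← Matrix.trace_transpose, Matrix.transpose_mul, Matrix.transpose_transpose,
    transpose_ketbra] at h
  rw [successProb_eq Φ₁ Φ₂ hρ]
  linarith

lemma trace_mul_ketbra_le_one {σ : Matrix A A ℂ} (hσ : IsDensity σ) (hφ : IsUnitVector φ) :
    (σ * ketbra φ).trace ≤ 1 := by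
  have hI : (1 - ketbra φ)ᴴ * (1 - ketbra φ) = 1 - ketbra φ := by
    rw [(isHermitian_one_sub_ketbra φ).eq, hφ.one_sub_ketbra_mul_self]
  have h := trace_mul_nonneg_of_posSemidef hσ.1
    (hI ▸ Matrix.posSemidef_conjTranspose_mul_self (1 - ketbra φ))
  rwa [Matrix.mul_sub, Matrix.mul_one, Matrix.trace_sub, hσ.2, sub_nonneg] at h

/-- An input whose success probability is at least `1/2 + ‖J‖₁/4` has the pure first marginal
`φ̄`, and is therefore a product state. -/
lemma eq_ketbra_kronecker_of_le_successProb (hne : Φ₁.toLinearMap ≠ Φ₂.toLinearMap)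
    (hφ : IsUnitVector φ)
    (hM : mOperator (differenceMap Φ₁ Φ₂)
        = (traceNorm (choi (differenceMap Φ₁ Φ₂)) : ℂ) • ketbra φ)
    {ρ : Matrix (A × C) (A × C) ℂ} (hρ : IsDensity ρ)
    (h : 1 / 2 + 1 / 4 * traceNorm (choi (differenceMap Φ₁ Φ₂)) ≤ successProb Φ₁ Φ₂ ρ) :
    ∃ τ : Matrix C C ℂ, IsDensity τ ∧ ρ = ketbra (star φ) ⊗ₖ τ := by
  have hpos : 0 < traceNorm (choi (differenceMap Φ₁ Φ₂)) := by
    refine lt_of_le_of_ne (traceNorm_nonneg _) fun h0 => hne ?_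
    rw [eq_comm, traceNorm_eq_zero_iff, choi_eq_zero_iff] at h0
    exact sub_eq_zero.mp h0
  have hφ' := isUnitVector_star hφ
  refine hρ.eq_ketbra_kronecker hφ' ?_
  have hle := Complex.le_def.mp (trace_mul_ketbra_le_one hρ.partialTraceRight hφ')
  have hge := h.trans (successProb_le hM hρ)
  refine Complex.ext (le_antisymm hle.1 ?_) hle.2
  rw [Complex.one_re]
  by_contra! hlt
  nlinarith

lemma IsOptimalInput.le_successProb (hφ : IsUnitVector φ)
    (hM : mOperator (differenceMap Φ₁ Φ₂)
        = (traceNorm (choi (differenceMap Φ₁ Φ₂)) : ℂ) • ketbra φ)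
    {ρ : Matrix (A × C) (A × C) ℂ} (hρ : IsOptimalInput Φ₁ Φ₂ ρ) :
    1 / 2 + 1 / 4 * traceNorm (choi (differenceMap Φ₁ Φ₂)) ≤ successProb Φ₁ Φ₂ ρ := by
  -- compare with `|φ̄⟩⟨φ̄|` and a trivial ancilla
  have hone : IsDensity (1 : Matrix (Fin 1) (Fin 1) ℂ) := ⟨Matrix.PosSemidef.one, by simp⟩
  rw [← successProb_ketbra_kronecker hφ hM hone]
  exact hρ.2 1 _ ((isUnitVector_star hφ).isDensity_ketbra.kronecker hone)

/-- No input, with or without ancilla, beats `1/2 + ‖J‖₁/4`. -/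
lemma successProb_le_of_isDensity (hφ : IsUnitVector φ)
    (hM : mOperator (differenceMap Φ₁ Φ₂)
        = (traceNorm (choi (differenceMap Φ₁ Φ₂)) : ℂ) • ketbra φ)
    {ρ : Matrix (A × C) (A × C) ℂ} (hρ : IsDensity ρ) :
    successProb Φ₁ Φ₂ ρ ≤ 1 / 2 + 1 / 4 * traceNorm (choi (differenceMap Φ₁ Φ₂)) := by
  have h1 := (Complex.le_def.mp
    (trace_mul_ketbra_le_one hρ.partialTraceRight (isUnitVector_star hφ))).1
  have h2 := mul_le_mul_of_nonneg_left h1 (traceNorm_nonneg (choi (differenceMap Φ₁ Φ₂)))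
  rw [Complex.one_re, mul_one] at h2
  linarith [successProb_le hM hρ]

lemma isOptimalInput_iff (hne : Φ₁.toLinearMap ≠ Φ₂.toLinearMap) (hφ : IsUnitVector φ)
    (hM : mOperator (differenceMap Φ₁ Φ₂)
        = (traceNorm (choi (differenceMap Φ₁ Φ₂)) : ℂ) • ketbra φ)
    (ρ : Matrix (A × C) (A × C) ℂ) :
    IsOptimalInput Φ₁ Φ₂ ρ ↔ ∃ τ : Matrix C C ℂ, IsDensity τ ∧ ρ = ketbra (star φ) ⊗ₖ τ := by
  refine ⟨fun hρ => eq_ketbra_kronecker_of_le_successProb hne hφ hM hρ.1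
    (hρ.le_successProb hφ hM), ?_⟩
  rintro ⟨τ, hτ, rfl⟩
  refine ⟨(isUnitVector_star hφ).isDensity_ketbra.kronecker hτ, fun n ρ' hρ' => ?_⟩
  rw [successProb_ketbra_kronecker hφ hM hτ]
  exact successProb_le_of_isDensity hφ hM hρ'

end Discrimination

end ChannelDiscrimination

theorem mainTheorem1 {A B : Type*}
    [Fintype A] [DecidableEq A] [Fintype B] [DecidableEq B]
    (Φ₁ Φ₂ : QuantumChannel A B) (hne : Φ₁.toLinearMap ≠ Φ₂.toLinearMap)
    (hΦ : IsMEWC Φ₁ Φ₂) :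
    ∃ φ : A → ℂ, IsUnitVector φ ∧
      mOperator (differenceMap Φ₁ Φ₂)
        = (traceNorm (choi (differenceMap Φ₁ Φ₂)) : ℂ) • ketbra φ ∧
      ∀ (A' : Type*) [Fintype A'] [DecidableEq A'],
        -- the optimal inputs are exactly the product states `|φ̄⟩⟨φ̄| ⊗ τ`
        (∀ ρ : Matrix (A × A') (A × A') ℂ, IsOptimalInput Φ₁ Φ₂ ρ ↔
          ∃ τ : Matrix A' A' ℂ, IsDensity τ ∧ ρ = ketbra (star φ) ⊗ₖ τ) ∧
        -- every optimal input is separable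
        (∀ ρ : Matrix (A × A') (A × A') ℂ, IsOptimalInput Φ₁ Φ₂ ρ → IsSeparableState ρ) ∧
        -- every entangled input is strictly worse than every optimal input
        (∀ ρ : Matrix (A × A') (A × A') ℂ, IsEntangledState ρ →
          ∀ (A'' : Type*) [Fintype A''] [DecidableEq A'']
            (ρ' : Matrix (A × A'') (A × A'') ℂ), IsOptimalInput Φ₁ Φ₂ ρ' →
            successProb Φ₁ Φ₂ ρ < successProb Φ₁ Φ₂ ρ') := by
  -- over an empty system the two channels would agree
  have hA : Nonempty A := by
    by_contra hA
    rw [not_nonempty_iff] at hA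
    exact hne (LinearMap.ext fun X => by rw [Subsingleton.elim X 0, map_zero, map_zero])
  obtain ⟨φ, hφ, hM⟩ := hΦ.exists_mOperator_eq
  have hφ' := (isUnitVector_star hφ).isDensity_ketbra
  refine ⟨φ, hφ, hM, fun A' _ _ => ⟨isOptimalInput_iff hne hφ hM, fun ρ hρ => ?_,
    fun ρ hρ A'' _ _ ρ' hρ' => ?_⟩⟩
  · obtain ⟨τ, hτ, rfl⟩ := (isOptimalInput_iff hne hφ hM ρ).mp hρ
    exact isSeparableState_kronecker hφ' hτ
  · by_contra! hle
    obtain ⟨τ, hτ, rfl⟩ := eq_ketbra_kronecker_of_le_successProb hne hφ hM hρ.1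
      ((hρ'.le_successProb hφ hM).trans hle)
    exact hρ.2 (isSeparableState_kronecker hφ' hτ)
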